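/- Let $X$ be a smooth complex projective variety or, more generally, a connected compact complex manifold, of dimension $m\ge 0$. Let $F\to X$ be a holomorphic vector bundle of rank $d+1$, let $0\le r\le d$, and let $\varrho_{r,d}\colon G(r+1,F)\to X$ be the Grassmann bundle of $(r+1)$-dimensional subspaces of the fibres $F_P$ of $F$, with its tautological subbundle $\mathcal S_r\subseteq\varrho_{r,d}^*F$. Let $\Gamma_{\rm triv}(\varrho_{r,d})$ be the set of holomorphic sections $\gamma\colon X\to G(r+1,F)$ of $\varrho_{r,d}$ for which $\gamma^*\mathcal S_r$, the subbundle of $F$ with fibre $\gamma(P)\subseteq F_P$ at $P$, is holomorphically trivial. Let $H^0(F)$ be the complex vector space of global holomorphic sections of $F$, and let $\mathcal U$ be the set of those $(r+1)$-dimensional subspaces $U\subseteq H^0(F)$ that are pointwise independent, i.e. such that for every $P\in X$ the evaluation map $U\to F_P$, $u\mapsto u(P)$, is injective. Then $\mathcal U$ is an open subset (in the usual, complex-manifold topology) of the Grassmannian $G(r+1,H^0(F))$, and there is a bijection $$\Gamma_{\rm triv}(\varrho_{r,d})\longrightarrow\mathcal U,\qquad \gamma\longmapsto U_\gamma,$$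 such that $\gamma(P)=\{u(P) : u\in U_\gamma\}$ for all $\gamma\in\Gamma_{\rm triv}(\varrho_{r,d})$ and all $P\in X$; moreover, for every isomorphism of holomorphic vector bundles $\phi\colon X\times\mathbb C^{r+1}\to\gamma^*\mathcal S_r$, the space $U_\gamma$ consists exactly of the sections $P\mapsto\phi(P,c)$ with $c\in\mathbb C^{r+1}$. In particular, if $\Gamma_{\rm triv}(\varrho_{r,d})$ is non-empty, it is identified with a non-empty open subset of $G(r+1,H^0(F))$. -/

import Mathlib

open Bundle Set
open scoped Manifold ContDiff Topology

/-! ### Grassmannians of complex vector spaces -/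

/-- `Gr k V` is the set `G(k, V)` of `k`-dimensional linear subspaces of a complex vector space. -/
def Gr (k : ℕ) (V : Type*) [AddCommGroup V] [Module ℂ V] : Type _ :=
  {W : Submodule ℂ V // FiniteDimensional ℂ W ∧ Module.finrank ℂ W = k}

namespace Gr

variable {k : ℕ} {V V' : Type*} [AddCommGroup V] [Module ℂ V] [AddCommGroup V'] [Module ℂ V']

/-- The image of a `k`-dimensional subspace under a linear isomorphism. -/
def map (f : V ≃ₗ[ℂ] V') (W : Gr k V) : Gr k V' :=
  ⟨W.1.map (f : V →ₗ[ℂ] V'), by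
    have := W.2.1
    exact ⟨inferInstance, (LinearEquiv.finrank_map_eq f W.1).trans W.2.2⟩⟩

/-- The span of a linearly independent family of `k` vectors (a `k`-frame). -/
noncomputable def ofFrame (v : {v : Fin k → V // LinearIndependent ℂ v}) : Gr k V :=
  ⟨Submodule.span ℂ (range v.1), FiniteDimensional.span_of_finite ℂ (finite_range _), by
    simpa using finrank_span_eq_card v.2⟩

/-- The topology of the space of `k`-frames of `V`: it is a subspace of the product `V ^ k`,
where `V` has its canonical topology (the finest topology making it a topological vector space over
`ℂ`; for finite-dimensional `V` this is the Euclidean topology). -/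
noncomputable abbrev frameTopology (k : ℕ) (V : Type*) [AddCommGroup V] [Module ℂ V] :
    TopologicalSpace {v : Fin k → V // LinearIndependent ℂ v} :=
  TopologicalSpace.induced Subtype.val
    (@Pi.topologicalSpace (Fin k) (fun _ => V) (fun _ => moduleTopology ℂ V))

/-- The Grassmannian has the quotient topology from the space of `k`-frames. -/
noncomputable instance : TopologicalSpace (Gr k V) :=
  TopologicalSpace.coinduced ofFrame (frameTopology k V)

end Gr

/-! ### Affine charts of the Grassmannian: subspaces that are graphs -/

section Graphs

/-- The affine space `Hom(ℂ^k, ℂ^(n-k))`, on which Grassmannians of `ℂ^n` are modelled. -/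
abbrev GrModel (n k : ℕ) : Type := (Fin k → ℂ) →L[ℂ] (Fin (n - k) → ℂ)

variable {n k : ℕ}

/-- The graph `{(a, T a)}` of `T` as a `k`-dimensional subspace of `ℂ^k × ℂ^(n-k)`. -/
def GrModel.graph (T : GrModel n k) : Gr k ((Fin k → ℂ) × (Fin (n - k) → ℂ)) :=
  ⟨(T : (Fin k → ℂ) →ₗ[ℂ] (Fin (n - k) → ℂ)).graph, inferInstance, by
    rw [LinearMap.graph_eq_range_prod, LinearMap.finrank_range_of_inj]
    · simp
    · intro a b h
      simpa using congrArg Prod.fst h⟩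

theorem GrModel.mem_graph {T : GrModel n k} {p : (Fin k → ℂ) × (Fin (n - k) → ℂ)} :
    p ∈ T.graph.1 ↔ p.2 = T p.1 := LinearMap.mem_graph_iff _ _

theorem GrModel.graph_injective : Function.Injective (GrModel.graph : GrModel n k → _) := by
  intro S T h
  ext1 a
  have : (a, S a) ∈ T.graph.1 := by
    rw [← h]; exact GrModel.mem_graph.2 rfl
  exact GrModel.mem_graph.1 this

open scoped Classical in
/-- The linear map of which a given subspace is the graph (zero if there is none). -/
noncomputable def GrModel.slope (G : Gr k ((Fin k → ℂ) × (Fin (n - k) → ℂ))) : GrModel n k :=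
  if h : ∃ T : GrModel n k, T.graph = G then h.choose else 0

theorem GrModel.graph_slope {G : Gr k ((Fin k → ℂ) × (Fin (n - k) → ℂ))}
    (h : ∃ T : GrModel n k, T.graph = G) : (GrModel.slope G).graph = G := by
  unfold GrModel.slope
  rw [dif_pos h]
  exact h.choose_spec

theorem GrModel.slope_graph (T : GrModel n k) : GrModel.slope T.graph = T :=
  GrModel.graph_injective (GrModel.graph_slope ⟨T, rfl⟩)

variable (M : ((Fin k → ℂ) × (Fin (n - k) → ℂ)) →L[ℂ] ((Fin k → ℂ) × (Fin (n - k) → ℂ)))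

/-- For a block matrix `M = (A B; C D)` this is `A + B T`. -/
noncomputable def GrModel.top (T : GrModel n k) : (Fin k → ℂ) →L[ℂ] (Fin k → ℂ) :=
  (ContinuousLinearMap.fst ℂ _ _).comp (M.comp
    (ContinuousLinearMap.inl ℂ _ _ + (ContinuousLinearMap.inr ℂ _ _).comp T))

/-- For a block matrix `M = (A B; C D)` this is `C + D T`. -/
noncomputable def GrModel.bot (T : GrModel n k) : GrModel n k :=
  (ContinuousLinearMap.snd ℂ _ _).comp (M.comp
    (ContinuousLinearMap.inl ℂ _ _ + (ContinuousLinearMap.inr ℂ _ _).comp T))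

theorem GrModel.apply_graph (T : GrModel n k) (a : Fin k → ℂ) :
    M (a, T a) = (GrModel.top M T a, GrModel.bot M T a) := by
  have h : ((a, T a) : (Fin k → ℂ) × (Fin (n - k) → ℂ)) = (a, 0) + (0, T a) := by simp
  rw [h]
  rfl

theorem GrModel.map_graph_of_isUnit
    (L : ((Fin k → ℂ) × (Fin (n - k) → ℂ)) ≃ₗ[ℂ] ((Fin k → ℂ) × (Fin (n - k) → ℂ)))
    (hL : ∀ p, L p = M p) (T : GrModel n k) (hu : IsUnit (GrModel.top M T)) :
    (GrModel.graph ((GrModel.bot M T).comp (Ring.inverse (GrModel.top M T)))) =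
      T.graph.map L := by
  obtain ⟨u, hu⟩ := hu
  have h1 : ∀ a, (↑u⁻¹ : (Fin k → ℂ) →L[ℂ] (Fin k → ℂ)) (GrModel.top M T a) = a := fun a => by
    rw [← hu]; exact congrArg (fun f => f a) u.inv_mul
  have h2 : ∀ a, GrModel.top M T ((↑u⁻¹ : (Fin k → ℂ) →L[ℂ] (Fin k → ℂ)) a) = a := fun a => by
    rw [← hu]; exact congrArg (fun f => f a) u.mul_inv
  apply Subtype.ext
  ext p
  rw [GrModel.mem_graph]
  constructor
  · intro h
    refine Submodule.mem_map.2 ⟨((↑u⁻¹ : (Fin k → ℂ) →L[ℂ] (Fin k → ℂ)) p.1,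
      T ((↑u⁻¹ : (Fin k → ℂ) →L[ℂ] (Fin k → ℂ)) p.1)), GrModel.mem_graph.2 rfl, ?_⟩
    refine (hL _).trans ?_
    rw [GrModel.apply_graph, h2]
    refine Prod.ext rfl ?_
    rw [h, ← hu, Ring.inverse_unit]
    rfl
  · intro h
    obtain ⟨q, hq, rfl⟩ := Submodule.mem_map.1 h
    have hq' : q = (q.1, T q.1) := Prod.ext rfl (GrModel.mem_graph.1 hq)
    have : (L : _ →ₗ[ℂ] _) q = (GrModel.top M T q.1, GrModel.bot M T q.1) := by
      rw [hq', ← GrModel.apply_graph]; exact hL _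
    rw [this]
    change _ = GrModel.bot M T (Ring.inverse (GrModel.top M T) (GrModel.top M T q.1))
    have h3 : Ring.inverse (GrModel.top M T) = ↑u⁻¹ := by rw [← hu, Ring.inverse_unit]
    rw [h3, h1]

theorem GrModel.isUnit_of_map_graph
    (L : ((Fin k → ℂ) × (Fin (n - k) → ℂ)) ≃ₗ[ℂ] ((Fin k → ℂ) × (Fin (n - k) → ℂ)))
    (hL : ∀ p, L p = M p) (T : GrModel n k) (h : ∃ S : GrModel n k, S.graph = T.graph.map L) :
    IsUnit (GrModel.top M T) := by
  obtain ⟨S, hS⟩ := h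
  have hinj : Function.Injective (GrModel.top M T) := by
    rw [injective_iff_map_eq_zero]
    intro a ha
    have hm : L (a, T a) ∈ S.graph.1 := by
      rw [hS]; exact Submodule.mem_map.2 ⟨_, GrModel.mem_graph.2 rfl, rfl⟩
    have h1 : L (a, T a) = (GrModel.top M T a, GrModel.bot M T a) := by
      rw [hL, GrModel.apply_graph]
    have h2 := GrModel.mem_graph.1 hm
    have h3 : L (a, T a) = 0 := by
      rw [h1] at h2 ⊢
      simp only [ha, map_zero] at h2 ⊢
      rw [h2]; rfl
    have h4 := (LinearEquiv.map_eq_zero_iff L).1 h3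
    exact congrArg Prod.fst h4
  have hbij : Function.Bijective (GrModel.top M T) :=
    ⟨hinj, LinearMap.injective_iff_surjective.1 hinj⟩
  exact ContinuousLinearMap.isUnit_iff_bijective.2 hbij

theorem GrModel.continuous_top : Continuous (fun p :
    (((Fin k → ℂ) × (Fin (n - k) → ℂ)) →L[ℂ] ((Fin k → ℂ) × (Fin (n - k) → ℂ))) × GrModel n k =>
    GrModel.top p.1 p.2) := by
  unfold GrModel.top; fun_prop

theorem GrModel.continuous_bot : Continuous (fun p :
    (((Fin k → ℂ) × (Fin (n - k) → ℂ)) →L[ℂ] ((Fin k → ℂ) × (Fin (n - k) → ℂ))) × GrModel n k =>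
    GrModel.bot p.1 p.2) := by
  unfold GrModel.bot; fun_prop

end Graphs

/-! ### The Grassmann bundle of a holomorphic vector bundle -/

section GrassmannBundle

/-- The total space of the Grassmann bundle `G(k, F) → X` of a bundle `F` of complex vector spaces
of rank `n`: a point is a pair `(P, W)` of a point `P` of `X` and a `k`-dimensional subspace `W`
of the fibre of `F` at `P`. -/
structure GrassmannBundle (n k : ℕ) {X : Type*} (F : X → Type*)
    [∀ x, AddCommGroup (F x)] [∀ x, Module ℂ (F x)] where
  /-- the point of `X` -/
  proj : X
  /-- the subspace of the fibre -/
  subspace : Gr k (F proj)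

variable {n k : ℕ} {X : Type*} [TopologicalSpace X] {F : X → Type*}
  [∀ x, AddCommGroup (F x)] [∀ x, Module ℂ (F x)]
  [TopologicalSpace (TotalSpace (Fin n → ℂ) F)] [∀ x, TopologicalSpace (F x)]
  [FiberBundle (Fin n → ℂ) F] [VectorBundle ℂ (Fin n → ℂ) F]

namespace GrassmannBundle

/-- The data of a chart of the Grassmann bundle: a local trivialization of `F`, and a splitting
`ℂ^n = ℂ^k × ℂ^(n-k)`. -/
structure ChartData (n k : ℕ) {X : Type*} [TopologicalSpace X] (F : X → Type*)
    [TopologicalSpace (TotalSpace (Fin n → ℂ) F)] [∀ x, TopologicalSpace (F x)]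
    [FiberBundle (Fin n → ℂ) F] where
  /-- the local trivialization -/
  triv : Trivialization (Fin n → ℂ) (π (Fin n → ℂ) F)
  mem : triv ∈ trivializationAtlas (Fin n → ℂ) F
  /-- the splitting -/
  split : (Fin n → ℂ) ≃ₗ[ℂ] (Fin k → ℂ) × (Fin (n - k) → ℂ)

instance (c : ChartData n k F) : MemTrivializationAtlas c.triv := ⟨c.mem⟩

open scoped Classical in
/-- The linear coordinates `F x ≃ ℂ^k × ℂ^(n-k)` at the points `x` over which the trivialization is
defined. (At other points, where it is not used, it is an arbitrary isomorphism.) -/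
noncomputable def ChartData.coord (c : ChartData n k F) (x : X) :
    F x ≃ₗ[ℂ] (Fin k → ℂ) × (Fin (n - k) → ℂ) :=
  (if hx : x ∈ c.triv.baseSet then c.triv.linearEquivAt ℂ x hx
    else (trivializationAt (Fin n → ℂ) F x).linearEquivAt ℂ x
      (mem_baseSet_trivializationAt (Fin n → ℂ) F x)).trans c.split

theorem _root_.Gr.map_symm_map {V V' : Type*} [AddCommGroup V] [Module ℂ V] [AddCommGroup V']
    [Module ℂ V'] (f : V ≃ₗ[ℂ] V') (W : Gr k V) : (W.map f).map f.symm = W := by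
  apply Subtype.ext
  ext v
  simp [Gr.map]

theorem _root_.Gr.map_map_symm {V V' : Type*} [AddCommGroup V] [Module ℂ V] [AddCommGroup V']
    [Module ℂ V'] (f : V ≃ₗ[ℂ] V') (W : Gr k V') : (W.map f.symm).map f = W :=
  Gr.map_symm_map f.symm W

theorem _root_.Gr.map_map {V V' V'' : Type*} [AddCommGroup V] [Module ℂ V] [AddCommGroup V']
    [Module ℂ V'] [AddCommGroup V''] [Module ℂ V''] (f : V ≃ₗ[ℂ] V') (g : V' ≃ₗ[ℂ] V'')
    (W : Gr k V) : (W.map f).map g = W.map (f.trans g) := by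
  apply Subtype.ext
  ext v
  simp [Gr.map]

/-- The chart `(x, W) ↦ (x, T)`, where `W ⊆ F x` is in coordinates the graph of `T`. -/
noncomputable def ChartData.chart (c : ChartData n k F) :
    PartialEquiv (GrassmannBundle n k F) (X × GrModel n k) where
  toFun p := (p.1, GrModel.slope (p.2.map (c.coord p.1)))
  invFun q := ⟨q.1, q.2.graph.map (c.coord q.1).symm⟩
  source := {p | p.1 ∈ c.triv.baseSet ∧ ∃ T : GrModel n k, T.graph = p.2.map (c.coord p.1)}
  target := c.triv.baseSet ×ˢ univ
  map_source' p hp := ⟨hp.1, mem_univ _⟩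
  map_target' q hq := ⟨hq.1, q.2, (Gr.map_map_symm _ _).symm⟩
  left_inv' := by
    rintro ⟨x, W⟩ hp
    refine congrArg (GrassmannBundle.mk x) ?_
    dsimp only
    rw [GrModel.graph_slope hp.2, Gr.map_symm_map]
  right_inv' := by
    rintro ⟨x, T⟩ -
    refine Prod.ext rfl ?_
    dsimp only
    rw [Gr.map_map_symm, GrModel.slope_graph]

/-- Every subspace is a graph in suitable coordinates. -/
theorem exists_split (W : Gr k (Fin n → ℂ)) :
    ∃ g : (Fin n → ℂ) ≃ₗ[ℂ] (Fin k → ℂ) × (Fin (n - k) → ℂ),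
      (0 : GrModel n k).graph = W.map g := by
  obtain ⟨W, hf, hk⟩ := W
  obtain ⟨Q, hQ⟩ := Submodule.exists_isCompl W
  have hn : Module.finrank ℂ W + Module.finrank ℂ Q = n := by
    rw [Submodule.finrank_add_eq_of_isCompl hQ]; simp
  let a : W ≃ₗ[ℂ] (Fin k → ℂ) := LinearEquiv.ofFinrankEq _ _ (by simp [hk])
  let b : Q ≃ₗ[ℂ] (Fin (n - k) → ℂ) := LinearEquiv.ofFinrankEq _ _ (by simp; omega)
  let e := W.prodEquivOfIsCompl Q hQ
  refine ⟨e.symm.trans (a.prodCongr b), ?_⟩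
  apply Subtype.ext
  ext p
  rw [GrModel.mem_graph]
  constructor
  · intro hp
    refine Submodule.mem_map.2 ⟨(a.symm p.1 : Fin n → ℂ), (a.symm p.1).2, ?_⟩
    have : e.symm ((a.symm p.1 : W) : Fin n → ℂ) = (a.symm p.1, 0) :=
      Submodule.prodEquivOfIsCompl_symm_apply_left W Q hQ _
    change (a.prodCongr b) (e.symm ((a.symm p.1 : W) : Fin n → ℂ)) = p
    rw [this]
    refine Prod.ext (a.apply_symm_apply _) ?_
    rw [hp]
    simp
  · intro hp
    obtain ⟨w, hw, rfl⟩ := Submodule.mem_map.1 hp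
    have : e.symm w = (⟨w, hw⟩, 0) :=
      Submodule.prodEquivOfIsCompl_symm_apply_left W Q hQ ⟨w, hw⟩
    change ((a.prodCongr b) (e.symm w)).2 = (0 : GrModel n k) _
    rw [this]
    simp

/-- A splitting for which the subspace `p.2` is a graph in the preferred trivialization at `p.1`. -/
noncomputable def chartDataAt (p : GrassmannBundle n k F) : ChartData n k F where
  triv := trivializationAt (Fin n → ℂ) F p.1
  mem := trivialization_mem_atlas (Fin n → ℂ) F p.1
  split := (exists_split (p.2.map ((trivializationAt (Fin n → ℂ) F p.1).linearEquivAt ℂ p.1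
    (mem_baseSet_trivializationAt (Fin n → ℂ) F p.1)))).choose

theorem mem_chartDataAt (p : GrassmannBundle n k F) : p ∈ (chartDataAt p).chart.source := by
  refine ⟨mem_baseSet_trivializationAt (Fin n → ℂ) F p.1, 0, ?_⟩
  have h := (exists_split (p.2.map ((trivializationAt (Fin n → ℂ) F p.1).linearEquivAt ℂ p.1
    (mem_baseSet_trivializationAt (Fin n → ℂ) F p.1)))).choose_spec
  rw [h, Gr.map_map]
  congr 1
  unfold ChartData.coord
  rw [dif_pos (show p.1 ∈ (chartDataAt p).triv.baseSet from
    mem_baseSet_trivializationAt (Fin n → ℂ) F p.1)]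
  rfl

/-- The matrix of the coordinate change between two charts, over a point of `X`. -/
noncomputable def ChartData.change (c c' : ChartData n k F) (x : X) :
    ((Fin k → ℂ) × (Fin (n - k) → ℂ)) →L[ℂ] ((Fin k → ℂ) × (Fin (n - k) → ℂ)) :=
  (c'.split.toContinuousLinearEquiv : _ →L[ℂ] _).comp
    ((c.triv.coordChangeL ℂ c'.triv x : (Fin n → ℂ) →L[ℂ] (Fin n → ℂ)).comp
      (c.split.symm.toContinuousLinearEquiv : _ →L[ℂ] _))

theorem ChartData.continuousOn_change (c c' : ChartData n k F) :
    ContinuousOn (c.change c') (c.triv.baseSet ∩ c'.triv.baseSet) :=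
  continuousOn_const.clm_comp
    ((VectorBundle.continuousOn_coordChange' c.triv c'.triv).clm_comp continuousOn_const)

theorem ChartData.change_apply (c c' : ChartData n k F) {x : X}
    (hx : x ∈ c.triv.baseSet ∩ c'.triv.baseSet) (p) :
    ((c.coord x).symm.trans (c'.coord x)) p = c.change c' x p := by
  unfold ChartData.coord ChartData.change
  rw [dif_pos hx.1, dif_pos hx.2]
  have := congrFun (c.triv.coe_coordChangeL (R := ℂ) c'.triv hx) (c.split.symm p)
  exact (congrArg c'.split this).symm

theorem ChartData.transition_source (c c' : ChartData n k F) :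
    (c.chart.symm.trans c'.chart).source =
      {q | q.1 ∈ c.triv.baseSet ∩ c'.triv.baseSet ∧ IsUnit (GrModel.top (c.change c' q.1) q.2)} := by
  ext ⟨x, T⟩
  rw [PartialEquiv.trans_source]
  constructor
  · rintro ⟨⟨h1, -⟩, h2, h3⟩
    refine ⟨⟨h1, h2⟩, GrModel.isUnit_of_map_graph _ _ (c.change_apply c' ⟨h1, h2⟩) T ?_⟩
    rw [← Gr.map_map]
    exact h3
  · rintro ⟨⟨h1, h2⟩, h3⟩
    refine ⟨⟨h1, mem_univ _⟩, h2, _,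
      (GrModel.map_graph_of_isUnit _ _ (c.change_apply c' ⟨h1, h2⟩) T h3).trans
        (Gr.map_map _ _ _).symm⟩

theorem ChartData.transition_apply (c c' : ChartData n k F) {q : X × GrModel n k}
    (hq : q ∈ (c.chart.symm.trans c'.chart).source) :
    (c.chart.symm.trans c'.chart) q = (q.1, (GrModel.bot (c.change c' q.1) q.2).comp
      (Ring.inverse (GrModel.top (c.change c' q.1) q.2))) := by
  rw [c.transition_source c'] at hq
  refine Prod.ext rfl ?_
  change GrModel.slope ((q.2.graph.map (c.coord q.1).symm).map (c'.coord q.1)) = _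
  rw [Gr.map_map, ← GrModel.map_graph_of_isUnit _ _ (c.change_apply c' hq.1) q.2 hq.2,
    GrModel.slope_graph]

theorem ChartData.continuousOn_change_prod (c c' : ChartData n k F) :
    ContinuousOn (fun q : X × GrModel n k => (c.change c' q.1, q.2))
      ((c.triv.baseSet ∩ c'.triv.baseSet) ×ˢ univ) :=
  ((c.continuousOn_change c').comp continuousOn_fst fun _ h => h.1).prodMk continuousOn_snd

/-- The atlas of the Grassmann bundle: over a trivializing open set of `F`, the subspaces which are
graphs with respect to a splitting of `ℂ^n` are parametrized by `Hom(ℂ^k, ℂ^(n-k))`. -/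
noncomputable def core (n k : ℕ) {X : Type*} [TopologicalSpace X] (F : X → Type*)
    [∀ x, AddCommGroup (F x)] [∀ x, Module ℂ (F x)]
    [TopologicalSpace (TotalSpace (Fin n → ℂ) F)] [∀ x, TopologicalSpace (F x)]
    [FiberBundle (Fin n → ℂ) F] [VectorBundle ℂ (Fin n → ℂ) F] :
    ChartedSpaceCore (X × GrModel n k) (GrassmannBundle n k F) where
  atlas := range ChartData.chart
  chartAt p := (chartDataAt p).chart
  mem_chart_source := mem_chartDataAt
  chart_mem_atlas p := mem_range_self _
  open_source := by
    rintro _ _ ⟨c, rfl⟩ ⟨c', rfl⟩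
    have ho : IsOpen ((c.triv.baseSet ∩ c'.triv.baseSet) ×ˢ (univ : Set (GrModel n k))) :=
      (c.triv.open_baseSet.inter c'.triv.open_baseSet).prod isOpen_univ
    have := (GrModel.continuous_top.comp_continuousOn (c.continuousOn_change_prod c')).isOpen_inter_preimage
      ho Units.isOpen
    rw [c.transition_source c']
    convert! this using 1
    ext q
    simp only [mem_ofPred_eq, mem_inter_iff, mem_prod, mem_univ, and_true, mem_preimage,
      Function.comp_apply]
  continuousOn_toFun := by
    rintro _ _ ⟨c, rfl⟩ ⟨c', rfl⟩
    refine ContinuousOn.congr ?_ fun q hq => c.transition_apply c' hq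
    rw [c.transition_source c']
    have hm : ContinuousOn (fun q : X × GrModel n k => (c.change c' q.1, q.2))
        {q | q.1 ∈ c.triv.baseSet ∩ c'.triv.baseSet ∧
          IsUnit (GrModel.top (c.change c' q.1) q.2)} :=
      (c.continuousOn_change_prod c').mono fun q hq => ⟨hq.1, mem_univ _⟩
    refine continuousOn_fst.prodMk
      ((GrModel.continuous_bot.comp_continuousOn hm).clm_comp fun q hq => ?_)
    obtain ⟨u, hu⟩ := hq.2
    have h1 : ContinuousAt Ring.inverse (GrModel.top (c.change c' q.1) q.2) := by
      rw [← hu]; exact NormedRing.inverse_continuousAt u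
    exact ContinuousAt.comp_continuousWithinAt (g := Ring.inverse) h1
      (GrModel.continuous_top.comp_continuousOn hm q hq)

noncomputable instance : TopologicalSpace (GrassmannBundle n k F) := (core n k F).toTopologicalSpace

/-- Charts of the Grassmann bundle with values in `X × Hom(ℂ^k, ℂ^(n-k))`. -/
noncomputable instance chartedSpace' : ChartedSpace (X × GrModel n k) (GrassmannBundle n k F) :=
  (core n k F).toChartedSpace

/-- If `X` is modelled on `H`, then the Grassmann bundle is modelled on `H × Hom(ℂ^k, ℂ^(n-k))`. -/
noncomputable instance chartedSpace {H : Type*} [TopologicalSpace H] [ChartedSpace H X] :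
    ChartedSpace (ModelProd H (GrModel n k)) (GrassmannBundle n k F) :=
  ChartedSpace.comp _ (X × GrModel n k) _

end GrassmannBundle

end GrassmannBundle

/-! ### Sections of the Grassmann bundle and global sections of `F`

`X` is a complex manifold of dimension `m`; holomorphic maps are the maps of class `ω`
(complex analytic maps). -/

section Sections

/-- `G(k, F)` is modelled on the finite-dimensional complex vector space
`ℂ^m × Hom(ℂ^k, ℂ^(n-k))`. -/
noncomputable abbrev grassmannBundleModel (m n k : ℕ) :=
  𝓘(ℂ, EuclideanSpace ℂ (Fin m)).prod 𝓘(ℂ, GrModel n k)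

/-- The set `Γ(ϱ)` of holomorphic sections of the Grassmann bundle `ϱ : G(k, F) → X`. -/
structure GrassmannSection (m n k : ℕ) {X : Type*} [TopologicalSpace X]
    [ChartedSpace (EuclideanSpace ℂ (Fin m)) X] (F : X → Type*)
    [∀ x, AddCommGroup (F x)] [∀ x, Module ℂ (F x)]
    [TopologicalSpace (TotalSpace (Fin n → ℂ) F)] [∀ x, TopologicalSpace (F x)]
    [FiberBundle (Fin n → ℂ) F] [VectorBundle ℂ (Fin n → ℂ) F] where
  /-- the value of the section at a point, a `k`-dimensional subspace of the fibre of `F` -/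
  toFun : ∀ x, Gr k (F x)
  holomorphic : ContMDiff 𝓘(ℂ, EuclideanSpace ℂ (Fin m)) (grassmannBundleModel m n k) ω
    (fun x => GrassmannBundle.mk (n := n) x (toFun x))

variable {m n k : ℕ} {X : Type*} [TopologicalSpace X]
  [ChartedSpace (EuclideanSpace ℂ (Fin m)) X] {F : X → Type*}
  [∀ x, AddCommGroup (F x)] [∀ x, Module ℂ (F x)]
  [TopologicalSpace (TotalSpace (Fin n → ℂ) F)] [∀ x, TopologicalSpace (F x)]
  [FiberBundle (Fin n → ℂ) F] [VectorBundle ℂ (Fin n → ℂ) F]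

/-- The fibre at `x` of the pull-back `γ^* S` of the tautological subbundle `S` along `γ`, as a
subspace of the fibre of `F`: it is the subspace `γ(x)` itself. -/
def GrassmannSection.tautFibre (γ : GrassmannSection m n k F) (x : X) : Submodule ℂ (F x) :=
  (γ.toFun x).1

/-- A holomorphic trivialization of `γ^* S`, i.e. an isomorphism `X × ℂ^k → γ^* S` of holomorphic
vector bundles. It is given by linear isomorphisms of the fibres which, over every open set,
identify the holomorphic `ℂ^k`-valued functions with the holomorphic sections of `γ^* S`, that is,
with the holomorphic sections of `F` taking values in the subbundle `γ^* S`. -/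
structure GrassmannSection.Trivialization (γ : GrassmannSection m n k F) where
  /-- the isomorphisms of the fibres -/
  iso : ∀ x, (Fin k → ℂ) ≃ₗ[ℂ] γ.tautFibre x
  holomorphic_iff : ∀ O : Set X, IsOpen O → ∀ f : X → Fin k → ℂ,
    ContMDiffOn 𝓘(ℂ, EuclideanSpace ℂ (Fin m)) 𝓘(ℂ, Fin k → ℂ) ω f O ↔
      ContMDiffOn 𝓘(ℂ, EuclideanSpace ℂ (Fin m))
        (𝓘(ℂ, EuclideanSpace ℂ (Fin m)).prod 𝓘(ℂ, Fin n → ℂ)) ω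
        (fun x => TotalSpace.mk' (Fin n → ℂ) x (iso x (f x) : F x)) O

variable (m n k F) in
/-- The set `Γ_triv(ϱ)` of the holomorphic sections `γ` of the Grassmann bundle for which the
pull-back `γ^* S` of the tautological subbundle is a trivial holomorphic bundle. -/
def gammaTriv : Set (GrassmannSection m n k F) :=
  {γ | Nonempty γ.Trivialization}

variable (m n F) in
/-- The complex vector space `H^0(F)` of global holomorphic sections of `F`. -/
abbrev HZero : Type _ :=
  ContMDiffSection 𝓘(ℂ, EuclideanSpace ℂ (Fin m)) (Fin n → ℂ) ω F

/-- Evaluation of global sections at a point, `H^0(F) → F x`. -/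
noncomputable def evalAt (x : X) : HZero m n F →ₗ[ℂ] F x where
  toFun s := s x
  map_add' _ _ := rfl
  map_smul' _ _ := rfl

variable (m n k F) in
/-- The `k`-dimensional spaces `U` of global sections of `F` that are pointwise independent:
sections in `U` that are linearly independent have linearly independent values at each point of `X`,
i.e. evaluation at each point is injective on `U`. -/
def pointwiseIndependent : Set (Gr k (HZero m n F)) :=
  {U | ∀ x : X, Function.Injective ((evalAt x).domRestrict U.1)}

end Sections

/-!
A trivialization `φ` of `γ^* S` turns every vector `c ∈ ℂ^k` into the global section `φ(·, c)` of
`F`, and these sections form a `k`-dimensional, pointwise independent space `U_γ` whose values at `x`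
fill out `γ(x)` (`GrassmannSection.Trivialization.sectionSpace`, `tautFibre_eq`). The space `U_γ` does
not depend on `φ`: the coordinates of a `φ`-constant section in another trivialization are holomorphic
functions on the compact connected manifold `X`, hence constants (`sectionSpace_le`). Since
`γ(x) = {u(x) : u ∈ U_γ}`, the map `γ ↦ U_γ` is injective.

Conversely, a basis `u` of a pointwise independent space `U` is a holomorphic frame. The subspaces
`γ(x)` spanned by its values vary holomorphically (`contMDiff_grassmannBundle_ofFrame`): in a chart
of the Grassmann bundle the frame is a matrix with an invertible block `P` over a block `Q`, and
`γ(x)` is the graph of `Q P⁻¹`. The frame trivializes `γ^* S` because the coefficients of a holomorphic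
combination of the `u i` are holomorphic (`contMDiffOn_sum_smul_iff`), the matrix of the frame having
a holomorphic left inverse locally. So `γ ↦ U_γ` is surjective.

Openness of the set of pointwise independent spaces is openness of the set of pointwise independent
frames. Independence at a point is an open condition on the pair (frame, point) since evaluation of
sections is jointly continuous (`eventually_linearIndependent_frame`), and compactness of `X` makes it
open in the frame uniformly in the point. Finite-dimensionality of `H^0(F)` is not needed: the
canonical topology is finer than any vector space topology, in particular than that of uniform
convergence in trivializations.
-/

/-! ### Holomorphic frames in local trivializations -/

section Frames

variable {m n k : ℕ} {X : Type*} [TopologicalSpace X]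
  [ChartedSpace (EuclideanSpace ℂ (Fin m)) X] {F : X → Type*}
  [∀ x, AddCommGroup (F x)] [∀ x, Module ℂ (F x)]
  [TopologicalSpace (TotalSpace (Fin n → ℂ) F)] [∀ x, TopologicalSpace (F x)]
  [FiberBundle (Fin n → ℂ) F] [VectorBundle ℂ (Fin n → ℂ) F]

/-- The `n × k` matrix, as a linear map `ℂ^k → ℂ^n`, whose columns are the values at `x` of the
sections `u i`, written in the preferred trivialization of `F` at `x₀`. It is meaningful for `x` in
the base set of that trivialization. -/
noncomputable def frameMatrix (u : Fin k → HZero m n F) (x₀ x : X) :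
    (Fin k → ℂ) →L[ℂ] (Fin n → ℂ) :=
  ∑ i, (ContinuousLinearMap.proj (R := ℂ) (φ := fun _ : Fin k => ℂ) i).smulRight
    (trivializationAt (Fin n → ℂ) F x₀ ⟨x, u i x⟩).2

theorem frameMatrix_apply (u : Fin k → HZero m n F) {x₀ x : X}
    (hx : x ∈ (trivializationAt (Fin n → ℂ) F x₀).baseSet) (a : Fin k → ℂ) :
    frameMatrix u x₀ x a = (trivializationAt (Fin n → ℂ) F x₀ ⟨x, ∑ i, a i • u i x⟩).2 := by
  have h := fun v : F x => (trivializationAt (Fin n → ℂ) F x₀).linearEquivAt_apply (R := ℂ) x hx v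
  simp only [← h, map_sum, map_smul]
  simp [frameMatrix, h]

omit [∀ x, AddCommGroup (F x)] [∀ x, Module ℂ (F x)] [VectorBundle ℂ (Fin n → ℂ) F] in
theorem contMDiffAt_frameMatrix (u : Fin k → HZero m n F) (x₀ : X) :
    ContMDiffAt 𝓘(ℂ, EuclideanSpace ℂ (Fin m)) 𝓘(ℂ, (Fin k → ℂ) →L[ℂ] (Fin n → ℂ)) ω
      (frameMatrix u x₀) x₀ := by
  have h : ContDiff ℂ ω fun v : Fin k → Fin n → ℂ =>
      ∑ i, (ContinuousLinearMap.proj (R := ℂ) (φ := fun _ : Fin k => ℂ) i).smulRight (v i) :=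
    ContDiff.sum fun i _ => contDiff_const.smulRight (contDiff_apply ℂ (Fin n → ℂ) i)
  have hu : ContMDiffAt 𝓘(ℂ, EuclideanSpace ℂ (Fin m)) 𝓘(ℂ, Fin k → Fin n → ℂ) ω
      (fun x i => (trivializationAt (Fin n → ℂ) F x₀ ⟨x, u i x⟩).2) x₀ :=
    contMDiffAt_pi_space.2 fun i => (contMDiffAt_section x₀).1 ((u i).contMDiff x₀)
  exact h.contDiffAt.comp_contMDiffAt hu

theorem frameMatrix_injective {u : Fin k → HZero m n F} {x₀ x : X}
    (hx : x ∈ (trivializationAt (Fin n → ℂ) F x₀).baseSet)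
    (hu : LinearIndependent ℂ fun i => u i x) : Function.Injective (frameMatrix u x₀ x) := by
  rw [injective_iff_map_eq_zero]
  intro a ha
  rw [frameMatrix_apply u hx, ← (trivializationAt (Fin n → ℂ) F x₀).linearEquivAt_apply (R := ℂ) x hx,
    LinearEquiv.map_eq_zero_iff] at ha
  exact funext (Fintype.linearIndependent_iff.1 hu a ha)

/-- A matrix-valued holomorphic function has a holomorphic inverse near a point where it is
invertible. -/
theorem ContMDiffWithinAt.ringInverse_clm {M : Type*} [TopologicalSpace M]
    [ChartedSpace (EuclideanSpace ℂ (Fin m)) M] {A : M → (Fin k → ℂ) →L[ℂ] (Fin k → ℂ)}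
    {s : Set M} {x₀ : M}
    (hA : ContMDiffWithinAt 𝓘(ℂ, EuclideanSpace ℂ (Fin m)) 𝓘(ℂ, (Fin k → ℂ) →L[ℂ] (Fin k → ℂ)) ω
      A s x₀) (h : IsUnit (A x₀)) :
    ContMDiffWithinAt 𝓘(ℂ, EuclideanSpace ℂ (Fin m)) 𝓘(ℂ, (Fin k → ℂ) →L[ℂ] (Fin k → ℂ)) ω
      (fun x => Ring.inverse (A x)) s x₀ := by
  obtain ⟨v, hv⟩ := h
  have h1 : ContDiffAt ℂ ω Ring.inverse (A x₀) := by rw [← hv]; exact contDiffAt_ringInverse ℂ v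
  exact h1.comp_contMDiffWithinAt hA

theorem ContinuousLinearMap.ringInverse_apply_apply {A : (Fin k → ℂ) →L[ℂ] (Fin k → ℂ)}
    (h : IsUnit A) (a : Fin k → ℂ) : Ring.inverse A (A a) = a :=
  congrArg (fun f : (Fin k → ℂ) →L[ℂ] (Fin k → ℂ) => f a) (Ring.inverse_mul_cancel A h)

theorem ContinuousLinearMap.apply_ringInverse_apply {A : (Fin k → ℂ) →L[ℂ] (Fin k → ℂ)}
    (h : IsUnit A) (a : Fin k → ℂ) : A (Ring.inverse A a) = a :=
  congrArg (fun f : (Fin k → ℂ) →L[ℂ] (Fin k → ℂ) => f a) (Ring.mul_inverse_cancel A h)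

/-- For a pointwise independent holomorphic frame `u`, the coefficients `f` of a section
`∑ i, f i • u i` are holomorphic if and only if the section is. -/
theorem contMDiffOn_sum_smul_iff {u : Fin k → HZero m n F}
    (hu : ∀ x, LinearIndependent ℂ fun i => u i x) (O : Set X) (f : X → Fin k → ℂ) :
    ContMDiffOn 𝓘(ℂ, EuclideanSpace ℂ (Fin m)) 𝓘(ℂ, Fin k → ℂ) ω f O ↔
      ContMDiffOn 𝓘(ℂ, EuclideanSpace ℂ (Fin m))
        (𝓘(ℂ, EuclideanSpace ℂ (Fin m)).prod 𝓘(ℂ, Fin n → ℂ)) ω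
        (fun x => TotalSpace.mk' (Fin n → ℂ) x (∑ i, f x i • u i x)) O := by
  refine forall₂_congr fun x₀ hx₀ => ?_
  rw [contMDiffWithinAt_section]
  have hb := mem_baseSet_trivializationAt (Fin n → ℂ) F x₀
  have hnear := (trivializationAt (Fin n → ℂ) F x₀).open_baseSet.mem_nhds hb
  have hA := (contMDiffAt_frameMatrix u x₀).contMDiffWithinAt (s := O)
  have hAf : ContMDiffWithinAt 𝓘(ℂ, EuclideanSpace ℂ (Fin m)) 𝓘(ℂ, Fin n → ℂ) ω
      (fun x => (trivializationAt (Fin n → ℂ) F x₀ ⟨x, ∑ i, f x i • u i x⟩).2) O x₀ ↔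
      ContMDiffWithinAt 𝓘(ℂ, EuclideanSpace ℂ (Fin m)) 𝓘(ℂ, Fin n → ℂ) ω
      (fun x => frameMatrix u x₀ x (f x)) O x₀ := by
    refine Filter.EventuallyEq.contMDiffWithinAt_iff ?_ (frameMatrix_apply u hb (f x₀)).symm
    filter_upwards [mem_nhdsWithin_of_mem_nhds hnear] with x hx
    exact (frameMatrix_apply u hx (f x)).symm
  rw [hAf]
  refine ⟨fun hf => hA.clm_apply hf, fun hg => ?_⟩
  -- A constant left inverse `B` of the matrix at `x₀` makes `B * A x` invertible for `x` near `x₀`.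
  obtain ⟨B, hB⟩ := LinearMap.exists_leftInverse_of_injective
    (frameMatrix u x₀ x₀ : (Fin k → ℂ) →ₗ[ℂ] (Fin n → ℂ))
    (LinearMap.ker_eq_bot.2 (frameMatrix_injective hb (hu x₀)))
  let B' : (Fin n → ℂ) →L[ℂ] (Fin k → ℂ) := LinearMap.toContinuousLinearMap B
  have hBA := (contMDiffWithinAt_const (c := B') (I := 𝓘(ℂ, EuclideanSpace ℂ (Fin m)))
    (n := ω)).clm_comp hA
  have h1 : B'.comp (frameMatrix u x₀ x₀) = 1 := by
    ext1 a; exact LinearMap.congr_fun hB a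
  have hunit : ∀ᶠ x in 𝓝[O] x₀, IsUnit (B'.comp (frameMatrix u x₀ x)) :=
    hBA.continuousWithinAt.preimage_mem_nhdsWithin
      (Units.isOpen.mem_nhds (by rw [mem_ofPred_eq, h1]; exact isUnit_one))
  have hinv := hBA.ringInverse_clm (by rw [h1]; exact isUnit_one)
  refine (hinv.clm_apply
    ((contMDiffWithinAt_const (c := B')).clm_apply hg)).congr_of_eventuallyEq ?_ ?_
  · filter_upwards [hunit] with x hx
    exact (ContinuousLinearMap.ringInverse_apply_apply hx (f x)).symm
  · exact (ContinuousLinearMap.ringInverse_apply_apply (hunit.self_of_nhdsWithin hx₀) (f x₀)).symm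

end Frames

/-! ### Holomorphic maps to the Grassmann bundle -/

section GrassmannMaps

variable {m n k : ℕ} {X : Type*} [TopologicalSpace X]
  [ChartedSpace (EuclideanSpace ℂ (Fin m)) X]
  {F : X → Type*}
  [∀ x, AddCommGroup (F x)] [∀ x, Module ℂ (F x)]
  [TopologicalSpace (TotalSpace (Fin n → ℂ) F)] [∀ x, TopologicalSpace (F x)]
  [FiberBundle (Fin n → ℂ) F] [VectorBundle ℂ (Fin n → ℂ) F]

theorem GrassmannBundle.ChartData.coord_apply (c : GrassmannBundle.ChartData n k F) {x : X}
    (hx : x ∈ c.triv.baseSet) (v : F x) : c.coord x v = c.split (c.triv ⟨x, v⟩).2 := by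
  unfold GrassmannBundle.ChartData.coord
  rw [dif_pos hx]
  exact congrArg c.split (c.triv.linearEquivAt_apply (R := ℂ) x hx v)

/-- A family of subspaces `W x ⊆ F x` is holomorphic at `x₀` if, in the chart of the Grassmann
bundle at `W x₀`, it is given by the graphs of a holomorphic family of linear maps. -/
theorem contMDiffAt_grassmannBundle_mk [IsManifold 𝓘(ℂ, EuclideanSpace ℂ (Fin m)) ω X]
    {W : ∀ x, Gr k (F x)} {x₀ : X} {T : X → GrModel n k}
    (hT : ContMDiffAt 𝓘(ℂ, EuclideanSpace ℂ (Fin m)) 𝓘(ℂ, GrModel n k) ω T x₀)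
    (hW : ∀ᶠ x in 𝓝 x₀, (T x).graph =
      (W x).map ((GrassmannBundle.chartDataAt (GrassmannBundle.mk x₀ (W x₀))).coord x)) :
    ContMDiffAt 𝓘(ℂ, EuclideanSpace ℂ (Fin m)) (grassmannBundleModel m n k) ω
      (fun x => GrassmannBundle.mk (n := n) x (W x)) x₀ := by
  set p : GrassmannBundle n k F := GrassmannBundle.mk x₀ (W x₀)
  set c := GrassmannBundle.chartDataAt p
  let e := chartAt (X × GrModel n k) p
  have hsymm : ∀ q, e.symm q = GrassmannBundle.mk q.1 (q.2.graph.map (c.coord q.1).symm) :=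
    fun q => rfl
  have htarget : e.target = c.triv.baseSet ×ˢ univ := rfl
  rw [contMDiffAt_iff_target]
  constructor
  · have h1 : ContinuousAt e.symm (x₀, T x₀) := by
      refine e.continuousAt_symm ?_
      rw [htarget]
      exact ⟨mem_baseSet_trivializationAt (Fin n → ℂ) F x₀, mem_univ _⟩
    have h2 : ContinuousAt (fun x => e.symm (x, T x)) x₀ :=
      ContinuousAt.comp (f := fun x => (x, T x)) h1 (continuousAt_id.prodMk hT.continuousAt)
    refine h2.congr ?_
    filter_upwards [hW] with x hx
    rw [hsymm]
    dsimp only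
    rw [hx, Gr.map_symm_map]
  · have h3 : ContMDiffAt 𝓘(ℂ, EuclideanSpace ℂ (Fin m))
        𝓘(ℂ, EuclideanSpace ℂ (Fin m) × GrModel n k) ω
        (fun x => (extChartAt 𝓘(ℂ, EuclideanSpace ℂ (Fin m)) x₀ x, T x)) x₀ :=
      contMDiffAt_extChartAt.prodMk_space hT
    refine h3.congr_of_eventuallyEq ?_
    filter_upwards [hW] with x hx
    change (extChartAt 𝓘(ℂ, EuclideanSpace ℂ (Fin m)) x₀ x,
      GrModel.slope ((W x).map (c.coord x))) = _
    rw [← hx, GrModel.slope_graph]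

/-- The subspaces spanned by the values of a pointwise independent holomorphic frame vary
holomorphically: in a chart of the Grassmann bundle, where the frame is given by an invertible block
`P x` over a block `Q x`, the span is the graph of `Q x * (P x)⁻¹`. -/
theorem contMDiff_grassmannBundle_ofFrame [IsManifold 𝓘(ℂ, EuclideanSpace ℂ (Fin m)) ω X]
    {u : Fin k → HZero m n F} (hu : ∀ x, LinearIndependent ℂ fun i => u i x) :
    ContMDiff 𝓘(ℂ, EuclideanSpace ℂ (Fin m)) (grassmannBundleModel m n k) ω
      (fun x => GrassmannBundle.mk (n := n) x (Gr.ofFrame ⟨fun i => u i x, hu x⟩)) := by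
  intro x₀
  set p : GrassmannBundle n k F := GrassmannBundle.mk x₀ (Gr.ofFrame ⟨fun i => u i x₀, hu x₀⟩)
  set c := GrassmannBundle.chartDataAt p
  let g : (Fin n → ℂ) →L[ℂ] (Fin k → ℂ) × (Fin (n - k) → ℂ) := c.split.toContinuousLinearEquiv
  let P : X → (Fin k → ℂ) →L[ℂ] (Fin k → ℂ) := fun x =>
    ((ContinuousLinearMap.fst ℂ _ _).comp g).comp (frameMatrix u x₀ x)
  let Q : X → (Fin k → ℂ) →L[ℂ] (Fin (n - k) → ℂ) := fun x =>
    ((ContinuousLinearMap.snd ℂ _ _).comp g).comp (frameMatrix u x₀ x)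
  have hb : x₀ ∈ c.triv.baseSet := mem_baseSet_trivializationAt (Fin n → ℂ) F x₀
  have hPQ : ∀ x ∈ c.triv.baseSet, ∀ a, c.coord x (∑ i, a i • u i x) = (P x a, Q x a) := by
    intro x hx a
    rw [c.coord_apply hx]
    exact congrArg c.split (frameMatrix_apply u hx a).symm
  have hmem : ∀ x (a : Fin k → ℂ), ∑ i, a i • u i x ∈ (Gr.ofFrame ⟨fun i => u i x, hu x⟩).1 := fun x a =>
    Submodule.sum_smul_mem _ _ fun i _ => Submodule.subset_span (mem_range_self i)
  have hA := contMDiffAt_frameMatrix u x₀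
  have hP : ContMDiffAt 𝓘(ℂ, EuclideanSpace ℂ (Fin m)) 𝓘(ℂ, (Fin k → ℂ) →L[ℂ] (Fin k → ℂ)) ω
      P x₀ := contMDiffAt_const.clm_comp hA
  have hQ : ContMDiffAt 𝓘(ℂ, EuclideanSpace ℂ (Fin m)) 𝓘(ℂ, GrModel n k) ω Q x₀ :=
    contMDiffAt_const.clm_comp hA
  have hunit₀ : IsUnit (P x₀) := by
    obtain ⟨T₀, hT₀⟩ := (GrassmannBundle.mem_chartDataAt p).2
    have hinj : Function.Injective (P x₀) := by
      rw [injective_iff_map_eq_zero]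
      intro a ha
      have h1 : c.coord x₀ (∑ i, a i • u i x₀) ∈ T₀.graph.1 := by
        rw [hT₀]; exact Submodule.mem_map.2 ⟨_, hmem x₀ a, rfl⟩
      have h2 := GrModel.mem_graph.1 h1
      have h3 : c.coord x₀ (∑ i, a i • u i x₀) = 0 := by
        rw [hPQ x₀ hb] at h2 ⊢
        simp only [ha, map_zero] at h2 ⊢
        rw [h2]; rfl
      exact funext (Fintype.linearIndependent_iff.1 (hu x₀) a ((LinearEquiv.map_eq_zero_iff _).1 h3))
    exact ContinuousLinearMap.isUnit_iff_bijective.2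
      ⟨hinj, LinearMap.injective_iff_surjective.1 hinj⟩
  have hunit : ∀ᶠ x in 𝓝 x₀, IsUnit (P x) :=
    hP.continuousAt.preimage_mem_nhds (Units.isOpen.mem_nhds hunit₀)
  have hinv : ContMDiffAt 𝓘(ℂ, EuclideanSpace ℂ (Fin m)) 𝓘(ℂ, (Fin k → ℂ) →L[ℂ] (Fin k → ℂ)) ω
      (fun x => Ring.inverse (P x)) x₀ :=
    ContMDiffWithinAt.ringInverse_clm hP hunit₀
  refine contMDiffAt_grassmannBundle_mk (T := fun x => (Q x).comp (Ring.inverse (P x)))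
    (hQ.clm_comp hinv) ?_
  filter_upwards [hunit, c.triv.open_baseSet.mem_nhds hb] with x hx hxb
  apply Subtype.ext
  ext q
  rw [GrModel.mem_graph]
  constructor
  · intro hq
    refine Submodule.mem_map.2 ⟨_, hmem x (Ring.inverse (P x) q.1), (hPQ x hxb _).trans ?_⟩
    refine Prod.ext ?_ hq.symm
    exact ContinuousLinearMap.apply_ringInverse_apply hx q.1
  · intro hq
    obtain ⟨w, hw, rfl⟩ := Submodule.mem_map.1 hq
    obtain ⟨a, rfl⟩ := (Submodule.mem_span_range_iff_exists_fun ℂ).1 hw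
    have h := hPQ x hxb a
    change (c.coord x (∑ i, a i • u i x)).2 =
      Q x (Ring.inverse (P x) (c.coord x (∑ i, a i • u i x)).1)
    rw [h]
    exact congrArg (Q x) (ContinuousLinearMap.ringInverse_apply_apply hx a).symm

end GrassmannMaps

/-! ### Openness of pointwise independence -/

section Openness

variable {m n k : ℕ} {X : Type*} [TopologicalSpace X]
  [ChartedSpace (EuclideanSpace ℂ (Fin m)) X] {F : X → Type*}
  [∀ x, AddCommGroup (F x)] [∀ x, Module ℂ (F x)]
  [TopologicalSpace (TotalSpace (Fin n → ℂ) F)] [∀ x, TopologicalSpace (F x)]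
  [FiberBundle (Fin n → ℂ) F] [VectorBundle ℂ (Fin n → ℂ) F]

/-- Restriction of global sections to a set `K` over which `F` is trivialized, as vector-valued
functions on `K`. -/
noncomputable def restrictTriv (x₀ : X) (K : Set X)
    (hK : K ⊆ (trivializationAt (Fin n → ℂ) F x₀).baseSet) :
    HZero m n F →ₗ[ℂ] C(K, Fin n → ℂ) where
  toFun s := ⟨fun x => (trivializationAt (Fin n → ℂ) F x₀ ⟨x, s x⟩).2, by
    have h : Continuous fun x : K => trivializationAt (Fin n → ℂ) F x₀ ⟨x, s x⟩ :=
      (trivializationAt (Fin n → ℂ) F x₀).continuousOn.comp_continuous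
        (s.contMDiff.continuous.comp continuous_subtype_val) fun x =>
          (trivializationAt (Fin n → ℂ) F x₀).mem_source.2 (hK x.2)
    exact continuous_snd.comp h⟩
  map_add' s t := by
    ext1 x
    exact ((trivializationAt (Fin n → ℂ) F x₀).linear ℂ (hK x.2)).1 (s x) (t x)
  map_smul' a s := by
    ext1 x
    exact ((trivializationAt (Fin n → ℂ) F x₀).linear ℂ (hK x.2)).2 a (s x)

/-- Evaluation of sections is jointly continuous for the canonical topology of `H^0(F)`, because
that topology is finer than the one of locally uniform convergence. Hence, in the canonical
topology, independence at a point is stable under small changes of both frame and point. -/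
theorem eventually_linearIndependent_frame [T2Space X] [CompactSpace X]
    {u₀ : Fin k → HZero m n F} {x₀ : X} (h₀ : LinearIndependent ℂ fun i => u₀ i x₀) :
    letI : TopologicalSpace (HZero m n F) := moduleTopology ℂ (HZero m n F)
    ∀ᶠ p : (Fin k → HZero m n F) × X in 𝓝 (u₀, x₀), LinearIndependent ℂ fun i => p.1 i p.2 := by
  let _ : TopologicalSpace (HZero m n F) := moduleTopology ℂ (HZero m n F)
  have : IsModuleTopology ℂ (HZero m n F) := ⟨rfl⟩
  set e := trivializationAt (Fin n → ℂ) F x₀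
  have hb : x₀ ∈ e.baseSet := mem_baseSet_trivializationAt (Fin n → ℂ) F x₀
  obtain ⟨K, hKn, hKb, hKc⟩ := local_compact_nhds (e.open_baseSet.mem_nhds hb)
  have : CompactSpace K := isCompact_iff_compactSpace.1 hKc
  have hcont : Continuous (restrictTriv (m := m) (F := F) x₀ K hKb) :=
    IsModuleTopology.continuous_of_linearMap _
  have hev : Continuous fun p : (Fin k → HZero m n F) × K =>
      fun i => restrictTriv x₀ K hKb (p.1 i) p.2 :=
    continuous_pi fun i =>
      (hcont.comp ((continuous_apply i).comp continuous_fst)).eval continuous_snd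
  have hind : ∀ (u : Fin k → HZero m n F) (x : K),
      LinearIndependent ℂ (fun i => restrictTriv x₀ K hKb (u i) x) ↔
        LinearIndependent ℂ fun i => u i x := by
    intro u x
    rw [← LinearMap.linearIndependent_iff ((e.linearEquivAt ℂ x (hKb x.2)) : F x →ₗ[ℂ] Fin n → ℂ)
      (LinearEquiv.ker _)]
    rfl
  have hopen : IsOpen {p : (Fin k → HZero m n F) × K |
      LinearIndependent ℂ fun i => p.1 i p.2} := by
    have := (isOpen_setOfPred_linearIndependent (𝕜 := ℂ) (E := Fin n → ℂ) (ι := Fin k)).preimage hev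
    convert this using 1
    ext p
    exact (hind p.1 p.2).symm
  have hmem := hopen.mem_nhds (show (u₀, (⟨x₀, mem_of_mem_nhds hKn⟩ : K)) ∈ _ from h₀)
  rw [nhds_prod_eq, nhds_subtype_eq_comap, Filter.mem_prod_iff] at hmem
  obtain ⟨A, hA, B, ⟨C, hC, hCB⟩, hAB⟩ := hmem
  rw [nhds_prod_eq]
  filter_upwards [Filter.prod_mem_prod hA (Filter.inter_mem hC hKn)] with p hp
  exact hAB (show (p.1, (⟨p.2, hp.2.2⟩ : K)) ∈ A ×ˢ B from ⟨hp.1, hCB hp.2.1⟩)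

/-- A subspace spanned by a frame is pointwise independent if and only if the frame is. -/
theorem ofFrame_mem_pointwiseIndependent {u : Fin k → HZero m n F} {hu : LinearIndependent ℂ u} :
    Gr.ofFrame ⟨u, hu⟩ ∈ pointwiseIndependent m n k F ↔
      ∀ x, LinearIndependent ℂ fun i => u i x := by
  refine forall_congr' fun x => ?_
  constructor
  · intro h
    have h1 := (Module.Basis.span hu).linearIndependent.map'
      ((evalAt x).domRestrict (Submodule.span ℂ (range u))) (LinearMap.ker_eq_bot.2 h)
    have h2 : ∀ i, (Module.Basis.span hu i : HZero m n F) = u i := fun i =>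
      congrArg Subtype.val (Module.Basis.span_apply hu i)
    have h3 : (evalAt x).domRestrict (Submodule.span ℂ (range u)) ∘ Module.Basis.span hu =
        fun i => u i x := funext fun i => congrArg (evalAt x) (h2 i)
    rwa [h3] at h1
  · intro h
    rw [injective_iff_map_eq_zero]
    rintro ⟨s, hs⟩ h0
    obtain ⟨a, rfl⟩ := (Submodule.mem_span_range_iff_exists_fun ℂ).1 hs
    have h1 : ∑ i, a i • u i x = 0 := by
      have h2 : evalAt x (∑ i, a i • u i) = 0 := h0
      rwa [map_sum] at h2
    have h3 := Fintype.linearIndependent_iff.1 h a h1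
    apply Subtype.ext
    simp [h3]

/-- By compactness of `X`, frames close to a pointwise independent one are pointwise independent. -/
theorem isOpen_pointwiseIndependent [T2Space X] [CompactSpace X] :
    IsOpen (pointwiseIndependent m n k F) := by
  let _ : TopologicalSpace (HZero m n F) := moduleTopology ℂ (HZero m n F)
  have hopen : IsOpen {u : Fin k → HZero m n F | ∀ x, LinearIndependent ℂ fun i => u i x} := by
    rw [isOpen_iff_mem_nhds]
    intro u₀ h₀
    have := (isCompact_univ (X := X)).eventually_forall_of_forall_eventually (x₀ := u₀)
      (P := fun u x => LinearIndependent ℂ fun i => u i x)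
      fun x _ => eventually_linearIndependent_frame (h₀ x)
    filter_upwards [this] with u hu x using hu x (mem_univ x)
  refine isOpen_coinduced.2 ⟨_, hopen, ?_⟩
  ext v
  exact ofFrame_mem_pointwiseIndependent.symm

end Openness

/-! ### Trivializations and spaces of global sections -/

section Correspondence

variable {m n k : ℕ} {X : Type*} [TopologicalSpace X]
  [ChartedSpace (EuclideanSpace ℂ (Fin m)) X] {F : X → Type*}
  [∀ x, AddCommGroup (F x)] [∀ x, Module ℂ (F x)]
  [TopologicalSpace (TotalSpace (Fin n → ℂ) F)] [∀ x, TopologicalSpace (F x)]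
  [FiberBundle (Fin n → ℂ) F] [VectorBundle ℂ (Fin n → ℂ) F]

namespace GrassmannSection

/-- The section of the Grassmann bundle spanned by a pointwise independent holomorphic frame. -/
noncomputable def ofFrame [IsManifold 𝓘(ℂ, EuclideanSpace ℂ (Fin m)) ω X] (u : Fin k → HZero m n F)
    (hu : ∀ x, LinearIndependent ℂ fun i => u i x) : GrassmannSection m n k F where
  toFun x := Gr.ofFrame ⟨fun i => u i x, hu x⟩
  holomorphic := contMDiff_grassmannBundle_ofFrame hu

/-- The trivialization `(x, c) ↦ ∑ i, c i • u i x` given by a pointwise independent frame. -/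
noncomputable def trivializationOfFrame [IsManifold 𝓘(ℂ, EuclideanSpace ℂ (Fin m)) ω X]
    (u : Fin k → HZero m n F) (hu : ∀ x, LinearIndependent ℂ fun i => u i x) :
    (ofFrame u hu).Trivialization where
  iso x := (Module.Basis.span (hu x)).equivFun.symm
  holomorphic_iff O _ f := by
    rw [contMDiffOn_sum_smul_iff hu O f]
    have h : ∀ x, (((Module.Basis.span (hu x)).equivFun.symm (f x) :
        Submodule.span ℂ (range fun i => u i x)) : F x) = ∑ i, f x i • u i x := fun x => by
      simp [Module.Basis.equivFun_symm_apply, Module.Basis.span_apply]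
    simp only [← h]
    rfl

/-- The map `c ↦ φ(·, c)` sending a vector to the corresponding constant section of `γ^* S`,
viewed as a global section of `F`. -/
noncomputable def Trivialization.constSection {γ : GrassmannSection m n k F}
    (φ : γ.Trivialization) : (Fin k → ℂ) →ₗ[ℂ] HZero m n F where
  toFun c := ⟨fun x => φ.iso x c, contMDiffOn_univ.1
    ((φ.holomorphic_iff univ isOpen_univ fun _ => c).1 contMDiffOn_const)⟩
  map_add' a b := by ext x; simp
  map_smul' a b := by ext x; simp

theorem Trivialization.constSection_apply {γ : GrassmannSection m n k F}
    (φ : γ.Trivialization) (c : Fin k → ℂ) (x : X) : φ.constSection c x = φ.iso x c := rfl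

theorem Trivialization.constSection_injective [Nonempty X] {γ : GrassmannSection m n k F}
    (φ : γ.Trivialization) : Function.Injective φ.constSection := by
  intro a b h
  obtain ⟨x⟩ := ‹Nonempty X›
  refine (φ.iso x).injective (Subtype.ext ?_)
  rw [← φ.constSection_apply, ← φ.constSection_apply, h]

/-- The space of the sections of `F` that are constant in a trivialization of `γ^* S`. -/
noncomputable def Trivialization.sectionSpace [Nonempty X] {γ : GrassmannSection m n k F}
    (φ : γ.Trivialization) : Gr k (HZero m n F) :=
  ⟨LinearMap.range φ.constSection, inferInstance, by
    rw [LinearMap.finrank_range_of_inj φ.constSection_injective]; simp⟩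

theorem Trivialization.mem_sectionSpace [Nonempty X] {γ : GrassmannSection m n k F}
    (φ : γ.Trivialization) {s : HZero m n F} :
    s ∈ φ.sectionSpace.1 ↔ ∃ c : Fin k → ℂ, ∀ x, s x = φ.iso x c := by
  constructor
  · rintro ⟨c, rfl⟩
    exact ⟨c, fun x => rfl⟩
  · rintro ⟨c, hc⟩
    exact ⟨c, ContMDiffSection.ext fun x => (hc x).symm⟩

theorem Trivialization.sectionSpace_mem_pointwiseIndependent [Nonempty X]
    {γ : GrassmannSection m n k F} (φ : γ.Trivialization) :
    φ.sectionSpace ∈ pointwiseIndependent m n k F := by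
  intro x
  rw [injective_iff_map_eq_zero]
  rintro ⟨s, c, rfl⟩ h
  have h1 : φ.iso x c = 0 := Subtype.ext h
  have h2 : c = 0 := (LinearEquiv.map_eq_zero_iff _).1 h1
  apply Subtype.ext
  simp [h2]

theorem Trivialization.tautFibre_eq [Nonempty X] {γ : GrassmannSection m n k F}
    (φ : γ.Trivialization) (x : X) : γ.tautFibre x = φ.sectionSpace.1.map (evalAt x) := by
  ext v
  constructor
  · intro hv
    refine Submodule.mem_map.2 ⟨φ.constSection ((φ.iso x).symm ⟨v, hv⟩), ⟨_, rfl⟩, ?_⟩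
    change ((φ.iso x ((φ.iso x).symm ⟨v, hv⟩) : γ.tautFibre x) : F x) = v
    rw [LinearEquiv.apply_symm_apply]
  · intro hv
    obtain ⟨_, ⟨c, rfl⟩, rfl⟩ := Submodule.mem_map.1 hv
    exact (φ.iso x c).2

/-- A section which is constant in one trivialization `φ` of `γ^* S` has holomorphic coordinates in
any other trivialization `ψ`; on a compact connected manifold these are constant. -/
theorem Trivialization.sectionSpace_le [CompactSpace X] [ConnectedSpace X]
    [IsManifold 𝓘(ℂ, EuclideanSpace ℂ (Fin m)) ω X]
    {γ : GrassmannSection m n k F} (φ ψ : γ.Trivialization) :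
    φ.sectionSpace.1 ≤ ψ.sectionSpace.1 := by
  rintro _ ⟨c, rfl⟩
  have hf : ContMDiffOn 𝓘(ℂ, EuclideanSpace ℂ (Fin m)) 𝓘(ℂ, Fin k → ℂ) ω
      (fun x => (ψ.iso x).symm (φ.iso x c)) univ := by
    rw [ψ.holomorphic_iff univ isOpen_univ]
    simp only [LinearEquiv.apply_symm_apply]
    exact (φ.constSection c).contMDiff.contMDiffOn
  have hd := (contMDiffOn_univ.1 hf).mdifferentiable (by simp)
  have : IsManifold 𝓘(ℂ, EuclideanSpace ℂ (Fin m)) 1 X :=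
    IsManifold.of_le (n := ω) le_top
  obtain ⟨a, ha⟩ := hd.exists_eq_const_of_compactSpace
  refine ψ.mem_sectionSpace.2 ⟨a, fun x => ?_⟩
  have hx : (ψ.iso x).symm (φ.iso x c) = a := congrFun ha x
  rw [← hx, LinearEquiv.apply_symm_apply, φ.constSection_apply]

theorem Trivialization.sectionSpace_eq [CompactSpace X] [ConnectedSpace X]
    [IsManifold 𝓘(ℂ, EuclideanSpace ℂ (Fin m)) ω X]
    {γ : GrassmannSection m n k F} (φ ψ : γ.Trivialization) :
    φ.sectionSpace = ψ.sectionSpace :=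
  Subtype.ext (le_antisymm (φ.sectionSpace_le ψ) (ψ.sectionSpace_le φ))

theorem sectionSpace_trivializationOfFrame [Nonempty X]
    [IsManifold 𝓘(ℂ, EuclideanSpace ℂ (Fin m)) ω X] {u : Fin k → HZero m n F}
    (hu : ∀ x, LinearIndependent ℂ fun i => u i x) :
    (trivializationOfFrame u hu).sectionSpace.1 = Submodule.span ℂ (range u) := by
  have h : ∀ (c : Fin k → ℂ) (x : X),
      ((trivializationOfFrame u hu).iso x c : F x) = (∑ i, c i • u i : HZero m n F) x := by
    intro c x
    have h1 : (((Module.Basis.span (hu x)).equivFun.symm c :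
        Submodule.span ℂ (range fun i => u i x)) : F x) = ∑ i, c i • u i x := by
      simp [Module.Basis.equivFun_symm_apply, Module.Basis.span_apply]
    have h2 : evalAt x (∑ i, c i • u i) = ∑ i, c i • u i x := by
      rw [map_sum]; rfl
    exact h1.trans h2.symm
  ext s
  rw [Trivialization.mem_sectionSpace, Submodule.mem_span_range_iff_exists_fun]
  refine exists_congr fun c => ?_
  simp only [h]
  exact ⟨fun hs => ContMDiffSection.ext fun x => (hs x).symm, fun hs x => by rw [hs]⟩

end GrassmannSection

end Correspondence

/-! ### The bijection -/

theorem mainTheorem12 {m d r : ℕ} (hr : r ≤ d)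
    {X : Type*} [TopologicalSpace X] [T2Space X] [CompactSpace X] [ConnectedSpace X]
    [ChartedSpace (EuclideanSpace ℂ (Fin m)) X]
    [IsManifold 𝓘(ℂ, EuclideanSpace ℂ (Fin m)) ω X]
    {F : X → Type*} [∀ x, AddCommGroup (F x)] [∀ x, Module ℂ (F x)]
    [TopologicalSpace (TotalSpace (Fin (d + 1) → ℂ) F)] [∀ x, TopologicalSpace (F x)]
    [FiberBundle (Fin (d + 1) → ℂ) F] [VectorBundle ℂ (Fin (d + 1) → ℂ) F]
    [ContMDiffVectorBundle ω (Fin (d + 1) → ℂ) F 𝓘(ℂ, EuclideanSpace ℂ (Fin m))] :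
    IsOpen (pointwiseIndependent m (d + 1) (r + 1) F) ∧
    ∃ Φ : gammaTriv m (d + 1) (r + 1) F ≃ pointwiseIndependent m (d + 1) (r + 1) F,
      (∀ (γ : gammaTriv m (d + 1) (r + 1) F) (x : X),
        γ.1.tautFibre x = (Φ γ).1.1.map (evalAt x)) ∧
      (∀ (γ : gammaTriv m (d + 1) (r + 1) F) (φ : γ.1.Trivialization)
        (s : HZero m (d + 1) F),
        s ∈ (Φ γ).1.1 ↔ ∃ c : Fin (r + 1) → ℂ, ∀ x, s x = φ.iso x c) := by
  let Ψ : gammaTriv m (d + 1) (r + 1) F → pointwiseIndependent m (d + 1) (r + 1) F := fun γ =>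
    ⟨γ.2.some.sectionSpace, γ.2.some.sectionSpace_mem_pointwiseIndependent⟩
  have hΨ : ∀ (γ : gammaTriv m (d + 1) (r + 1) F) (x : X),
      γ.1.tautFibre x = (Ψ γ).1.1.map (evalAt x) := fun γ => γ.2.some.tautFibre_eq
  have hbij : Function.Bijective Ψ := by
    constructor
    · intro γ γ' h
      have h1 : ∀ x, γ.1.toFun x = γ'.1.toFun x := fun x =>
        Subtype.ext ((hΨ γ x).trans ((congrArg (fun U => U.1.1.map (evalAt x)) h).trans
          (hΨ γ' x).symm))
      obtain ⟨⟨f, _⟩, _⟩ := γ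
      obtain ⟨⟨f', _⟩, _⟩ := γ'
      obtain rfl : f = f' := funext h1
      rfl
    · rintro ⟨⟨U, hfin, hrank⟩, hU⟩
      let b := Module.finBasisOfFinrankEq ℂ U hrank
      let u : Fin (r + 1) → HZero m (d + 1) F := fun i => b i
      have hli : LinearIndependent ℂ u := b.linearIndependent.map' U.subtype U.ker_subtype
      have hspan : Submodule.span ℂ (range u) = U := by
        have h := congrArg (Submodule.map U.subtype) b.span_eq
        rwa [Submodule.map_span, Submodule.map_top, Submodule.range_subtype, ← range_comp] at h
      have hframe : Gr.ofFrame ⟨u, hli⟩ = ⟨U, hfin, hrank⟩ := Subtype.ext hspan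
      have hu : ∀ x, LinearIndependent ℂ fun i => u i x :=
        ofFrame_mem_pointwiseIndependent.1 (hframe ▸ hU)
      have hmem : GrassmannSection.ofFrame u hu ∈ gammaTriv m (d + 1) (r + 1) F :=
        ⟨GrassmannSection.trivializationOfFrame u hu⟩
      refine ⟨⟨_, hmem⟩, Subtype.ext (Subtype.ext ?_)⟩
      exact (congrArg Subtype.val (hmem.some.sectionSpace_eq _)).trans
        ((GrassmannSection.sectionSpace_trivializationOfFrame hu).trans hspan)
  refine ⟨isOpen_pointwiseIndependent, Equiv.ofBijective Ψ hbij, hΨ, fun γ φ s => ?_⟩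
  rw [← φ.mem_sectionSpace, φ.sectionSpace_eq γ.2.some]
  rfl
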